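/- Let $\mathfrak g=\mathfrak g_{\bar0}\oplus\mathfrak g_{\bar1}$ be a complex Lie superalgebra which is either basic (finite-dimensional, simple, with $\mathfrak g_{\bar1}$ a completely reducible $\mathfrak g_{\bar0}$-module, and with a nondegenerate invariant even bilinear form; simple Lie algebras are allowed) or isomorphic to $\mathfrak{sl}(n,n)$, $n\ge 2$. Let $A$ be an associative commutative unital $\mathbb C$-algebra, and let $\mathfrak g\otimes A$ be the Lie superalgebra with $[x\otimes a,y\otimes b]=[x,y]\otimes ab$; regard $\mathfrak g$ as a subalgebra via $x\mapsto x\otimes 1$. Modules over a Lie superalgebra are modules over its universal enveloping algebra $U(\cdot)$. Fix a Cartan subalgebra $\mathfrak h$ of $\mathfrak g_{\bar 0}$ and a system of simple roots $\Sigma$: a linearly independent set of roots $\beta$ with homogeneous vectors $0\ne X_\beta\in\mathfrak g_\beta$, $Y_\beta\in\mathfrak g_{-\beta}$ such that $[X_\beta,Y_{\beta'}]=0$ for $\beta\neq\beta'$ and the $X_\beta$, $Y_\beta$ and $\mathfrak h$ generate $\mathfrak g$. Here roots are linear forms on a space $T$ of commuting even derivations of $\mathfrak g$ which contains $\operatorname{ad}\mathfrak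 h$ and satisfies $\mathfrak g^T=\mathfrak h$. If $\mathfrak g$ is basic and not of type $A(n,n)$, then $T=\operatorname{ad}\mathfrak h\cong\mathfrak h$ and these are the usual roots; if $\mathfrak g$ is $\mathfrak{sl}(n,n)$ or $A(n-1,n-1)$, then $T$ is given by the Cartan subalgebra of $\mathfrak{gl}(n,n)$, i.e. roots are those of $\mathfrak{gl}(n,n)$. Let $\mathfrak n^+$ be the subalgebra generated by the $X_\beta$, let $Q^+=\sum_{\beta\in\Sigma}\mathbb N\beta$, and let $\Sigma(\mathfrak g_{\bar0})$ be the set of simple roots of $\mathfrak g_{\bar 0}$, that is, the set of those (nonzero) even roots in $Q^+$ which are not sums of two even roots in $Q^+$. For $\alpha\in\Sigma(\mathfrak g_{\bar0})$ choose an $\mathfrak{sl}(2)$-triple $X_\alpha\in\mathfrak g_\alpha$, $Y_\alpha\in\mathfrak g_{-\alpha}$, $H_\alpha=[X_\alpha,Y_\alpha]\in\mathfrak h$. Let $\Lambda^+\subseteq\mathfrak h^*$ be the set of $\lambda$ for which the irreducible $\mathfrak g$-module of highest weight $\lambda$ is finite-dimensional; then $\lambda(H_\alpha)\in\mathbb N$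 for $\lambda\in\Lambda^+$ and $\alpha\in\Sigma(\mathfrak g_{\bar0})$. For $\lambda\in\Lambda^+$ let $\bar V(\lambda)$ be the $\mathfrak g$-module generated by a vector $v_\lambda$ with defining relations $\mathfrak n^+v_\lambda=0$, $hv_\lambda=\lambda(h)v_\lambda$ ($h\in\mathfrak h$) and $Y_\alpha^{\lambda(H_\alpha)+1}v_\lambda=0$ ($\alpha\in\Sigma(\mathfrak g_{\bar0})$). Let $P=P_A(\bar V(\lambda))=U(\mathfrak g\otimes A)\otimes_{U(\mathfrak g)}\bar V(\lambda)$, and let the global Weyl module be $$W(\lambda)=P\Big/\sum_{\mu\notin\lambda-Q^+}U(\mathfrak g\otimes A)P_\mu .$$ Here, for $\nu\in T^*$, the weight space $P_{\lambda+\nu}$ is spanned by the vectors $(x_1\otimes a_1)\cdots(x_k\otimes a_k)(1\otimes v_\lambda)$ with $a_i\in A$, $x_i\in\mathfrak g_{\alpha_i}$ and $\alpha_1+\dots+\alpha_k=\nu$ (where $\mathfrak g_0=\mathfrak h$); for $T=\operatorname{ad}\mathfrak h$ it is the usual weight space of $\mathfrak h$. Let $w_\lambda$ be the image of $1\otimes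 v_\lambda$ in $W(\lambda)$. **Proposition.** For $\lambda\in\Lambda^+$, the $\mathfrak g\otimes A$-module $W(\lambda)$ is generated by $w_\lambda$, with defining relations $$(\mathfrak n^+\otimes A)w_\lambda=0,\qquad hw_\lambda=\lambda(h)w_\lambda,\qquad Y_\alpha^{\lambda(H_\alpha)+1}w_\lambda=0\qquad\text{for all }h\in\mathfrak h,\ \alpha\in\Sigma(\mathfrak g_{\bar0}).$$ That is, if $J$ is the left ideal of $U(\mathfrak g\otimes A)$ generated by all $x\otimes a$ ($x\in\mathfrak n^+$, $a\in A$), $h\otimes1-\lambda(h)$ and $(Y_\alpha\otimes1)^{\lambda(H_\alpha)+1}$, then there is an isomorphism of $\mathfrak g\otimes A$-modules $U(\mathfrak g\otimes A)/J\cong W(\lambda)$ with $1\mapsto w_\lambda$. -/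

import Mathlib

open scoped TensorProduct

noncomputable section

namespace SuperWeyl

universe u v

/-! ### Lie superalgebras over the complex numbers -/

/-- The sign `(-1)^{ij}` for parities `i, j`. -/
def koszul (i j : ZMod 2) : ℂ := (-1) ^ (i.val * j.val)

/-- A complex Lie superalgebra: a `ℤ/2`-graded vector space with a bilinear bracket which respects
the grading, is skew-supersymmetric, and satisfies the super Jacobi identity. -/
class LieSuperalgebra (L : Type u) [AddCommGroup L] [Module ℂ L] where
  parity : ZMod 2 → Submodule ℂ L
  isCompl_parity : IsCompl (parity 0) (parity 1)
  br : L →ₗ[ℂ] L →ₗ[ℂ] L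
  br_mem : ∀ {i j : ZMod 2} {x y : L}, x ∈ parity i → y ∈ parity j → br x y ∈ parity (i + j)
  br_skew : ∀ {i j : ZMod 2} {x y : L}, x ∈ parity i → y ∈ parity j →
    br x y = -(koszul i j • br y x)
  br_jacobi : ∀ {i j : ZMod 2} {x y : L} (z : L), x ∈ parity i → y ∈ parity j →
    br x (br y z) = br (br x y) z + koszul i j • br y (br x z)

open LieSuperalgebra

section Super

variable (L : Type u) [AddCommGroup L] [Module ℂ L] [LieSuperalgebra L]

variable {L} in
/-- The subalgebra generated by a set: the smallest subspace containing it and closed under the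
bracket. -/
def lieSpan (s : Set L) : Submodule ℂ L :=
  sInf {p | s ⊆ p ∧ ∀ x ∈ p, ∀ y ∈ p, br x y ∈ p}

/-- Simplicity: the bracket is not zero, and there are no nonzero proper graded ideals. -/
def IsSimpleSuper : Prop :=
  (∃ x y : L, br x y ≠ 0) ∧
  ∀ I : Submodule ℂ L, I = (I ⊓ parity 0) ⊔ (I ⊓ parity 1) → (∀ x ∈ I, ∀ y, br x y ∈ I) →
    I = ⊥ ∨ I = ⊤

/-- The odd part is a completely reducible module over the even part. -/
def OddPartCompletelyReducible : Prop :=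
  ∀ N : Submodule ℂ L, N ≤ parity 1 → (∀ x ∈ parity (L := L) 0, ∀ y ∈ N, br x y ∈ N) →
    ∃ N' : Submodule ℂ L, N' ≤ parity 1 ∧ (∀ x ∈ parity (L := L) 0, ∀ y ∈ N', br x y ∈ N') ∧
      N ⊓ N' = ⊥ ∧ N ⊔ N' = parity 1

/-- Existence of a nondegenerate invariant even bilinear form. -/
def HasInvariantForm : Prop :=
  ∃ B : LinearMap.BilinForm ℂ L, B.Nondegenerate ∧
    (∀ x ∈ parity (L := L) 0, ∀ y ∈ parity (L := L) 1, B x y = 0 ∧ B y x = 0) ∧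
    ∀ x y z, B (br x y) z = B x (br y z)

/-- Basic (classical) Lie superalgebras; finite-dimensional simple Lie algebras are included. -/
structure IsBasic : Prop where
  finite : FiniteDimensional ℂ L
  simple : IsSimpleSuper L
  classical : OddPartCompletelyReducible L
  form : HasInvariantForm L

/-- `L` is isomorphic to `𝔰𝔩(n,n)`: the `(n+n) × (n+n)` complex matrices of supertrace zero, where
the even elements are the block-diagonal matrices, the odd elements are the block-off-diagonal
matrices, and the bracket is the supercommutator. -/
def IsSpecialLinear (n : ℕ) : Prop :=
  ∃ e : L →ₗ[ℂ] Matrix (Fin n ⊕ Fin n) (Fin n ⊕ Fin n) ℂ,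
    Function.Injective e ∧
    (∀ M, M ∈ LinearMap.range e ↔ M.toBlocks₁₁.trace - M.toBlocks₂₂.trace = 0) ∧
    (∀ x, x ∈ parity (L := L) 0 ↔ (e x).toBlocks₁₂ = 0 ∧ (e x).toBlocks₂₁ = 0) ∧
    (∀ x, x ∈ parity (L := L) 1 ↔ (e x).toBlocks₁₁ = 0 ∧ (e x).toBlocks₂₂ = 0) ∧
    ∀ (i j : ZMod 2) (x y : L), x ∈ parity (L := L) i → y ∈ parity (L := L) j →
      e (br x y) = e x * e y - koszul i j • (e y * e x)

/-! ### The universal enveloping superalgebra -/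

/-- The relations `x y - (-1)^{|x||y|} y x = [x, y]` for homogeneous `x`, `y`. -/
inductive EnvRel : TensorAlgebra ℂ L → TensorAlgebra ℂ L → Prop
  | mk {i j : ZMod 2} {x y : L} (hx : x ∈ parity (L := L) i) (hy : y ∈ parity (L := L) j) :
      EnvRel
        (TensorAlgebra.ι ℂ x * TensorAlgebra.ι ℂ y
          - koszul i j • (TensorAlgebra.ι ℂ y * TensorAlgebra.ι ℂ x))
        (TensorAlgebra.ι ℂ (br x y))

/-- The universal enveloping algebra of a Lie superalgebra. A module over the Lie superalgebra is a
module over this ring. -/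
abbrev Env : Type u := RingQuot (EnvRel L)

variable {L}

/-- The canonical map from a Lie superalgebra to its universal enveloping algebra. -/
def Env.ι : L →ₗ[ℂ] Env L :=
  (RingQuot.mkAlgHom ℂ (EnvRel L)).toLinearMap ∘ₗ TensorAlgebra.ι ℂ

lemma Env.ι_br {i j : ZMod 2} {x y : L} (hx : x ∈ parity (L := L) i)
    (hy : y ∈ parity (L := L) j) :
    Env.ι x * Env.ι y - koszul i j • (Env.ι y * Env.ι x) = Env.ι (br x y) := by
  have := RingQuot.mkAlgHom_rel ℂ (EnvRel.mk hx hy)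
  simpa [Env.ι] using this

/-- The universal property of the enveloping algebra. -/
def Env.lift {B : Type*} [Ring B] [Algebra ℂ B] (f : L →ₗ[ℂ] B)
    (hf : ∀ (i j : ZMod 2) (x y : L), x ∈ parity (L := L) i → y ∈ parity (L := L) j →
      f x * f y - koszul i j • (f y * f x) = f (br x y)) : Env L →ₐ[ℂ] B :=
  RingQuot.liftAlgHom ℂ ⟨TensorAlgebra.lift ℂ f, by
    rintro _ _ ⟨hx, hy⟩
    simpa using hf _ _ _ _ hx hy⟩

lemma Env.lift_ι {B : Type*} [Ring B] [Algebra ℂ B] (f : L →ₗ[ℂ] B) (hf) (x : L) :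
    Env.lift f hf (Env.ι x) = f x := by
  simp [Env.lift, Env.ι]

end Super

/-! ### Map Lie superalgebras -/

section MapSuper

variable {L : Type u} [AddCommGroup L] [Module ℂ L] [LieSuperalgebra L]
  {A : Type v} [CommRing A] [Algebra ℂ A]

variable (L A) in
/-- The homogeneous components `L_i ⊗ A` of `L ⊗ A`. -/
def mapParity (i : ZMod 2) : Submodule ℂ (L ⊗[ℂ] A) :=
  Submodule.span ℂ {z | ∃ x ∈ parity (L := L) i, ∃ a : A, x ⊗ₜ[ℂ] a = z}

variable (L A) in
/-- The bracket `[x ⊗ a, y ⊗ b] = [x, y] ⊗ ab`. -/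
def mapBr : L ⊗[ℂ] A →ₗ[ℂ] L ⊗[ℂ] A →ₗ[ℂ] L ⊗[ℂ] A :=
  TensorProduct.map₂ br (LinearMap.mul ℂ A)

lemma mapBr_tmul (x y : L) (a b : A) :
    mapBr L A (x ⊗ₜ a) (y ⊗ₜ b) = br x y ⊗ₜ (a * b) := by
  simp [mapBr]

lemma isCompl_mapParity : IsCompl (mapParity L A 0) (mapParity L A 1) := by
  have hc := isCompl_parity (L := L)
  constructor
  · let P : L →ₗ[ℂ] L := Submodule.projection _ _ hc
    let PA : L ⊗[ℂ] A →ₗ[ℂ] L ⊗[ℂ] A := TensorProduct.map P LinearMap.id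
    have h0 : ∀ z ∈ mapParity L A 0, PA z = z := by
      intro z hz
      induction hz using Submodule.span_induction with
      | mem z h =>
        obtain ⟨x, hx, a, rfl⟩ := h
        simp only [PA, P, TensorProduct.map_tmul, LinearMap.id_apply]
        rw [Submodule.projection_apply_left hc ⟨x, hx⟩]
      | zero => simp
      | add x y _ _ h1 h2 => rw [map_add, h1, h2]
      | smul c x _ h => rw [map_smul, h]
    have h1 : ∀ z ∈ mapParity L A 1, PA z = 0 := by
      intro z hz
      induction hz using Submodule.span_induction with
      | mem z h =>
        obtain ⟨x, hx, a, rfl⟩ := h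
        simp only [PA, P, TensorProduct.map_tmul, LinearMap.id_apply]
        rw [Submodule.projection_apply_right hc ⟨x, hx⟩]
        simp
      | zero => simp
      | add x y _ _ h1 h2 => rw [map_add, h1, h2, add_zero]
      | smul c x _ h => rw [map_smul, h, smul_zero]
    rw [Submodule.disjoint_def]
    intro z hz0 hz1
    rw [← h0 z hz0, h1 z hz1]
  · rw [codisjoint_iff, eq_top_iff]
    rintro z -
    induction z with
    | zero => exact zero_mem _
    | add x y hx hy => exact add_mem hx hy
    | tmul x a =>
      have hx : x ∈ parity (L := L) 0 ⊔ parity 1 := by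
        rw [hc.sup_eq_top]; exact Submodule.mem_top
      obtain ⟨y, hy, w, hw, rfl⟩ := Submodule.mem_sup.1 hx
      rw [TensorProduct.add_tmul]
      exact add_mem (Submodule.mem_sup_left (Submodule.subset_span ⟨y, hy, a, rfl⟩))
        (Submodule.mem_sup_right (Submodule.subset_span ⟨w, hw, a, rfl⟩))

/-- The map Lie superalgebra `L ⊗ A`. -/
instance mapSuperalgebra : LieSuperalgebra (L ⊗[ℂ] A) where
  parity := mapParity L A
  isCompl_parity := isCompl_mapParity
  br := mapBr L A
  br_mem := by
    intro i j x y hx hy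
    induction hx using Submodule.span_induction with
    | zero => simp
    | add x x' _ _ h1 h2 => rw [map_add, LinearMap.add_apply]; exact add_mem h1 h2
    | smul c x _ h => rw [map_smul, LinearMap.smul_apply]; exact Submodule.smul_mem _ _ h
    | mem x h =>
      obtain ⟨x, hx, a, rfl⟩ := h
      induction hy using Submodule.span_induction with
      | zero => simp
      | add x x' _ _ h1 h2 => rw [map_add]; exact add_mem h1 h2
      | smul c x _ h => rw [map_smul]; exact Submodule.smul_mem _ _ h
      | mem y h =>
        obtain ⟨y, hy, b, rfl⟩ := h
        rw [mapBr_tmul]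
        exact Submodule.subset_span ⟨_, br_mem hx hy, _, rfl⟩
  br_skew := by
    intro i j x y hx hy
    induction hx using Submodule.span_induction with
    | zero => simp
    | add x x' _ _ h1 h2 =>
      rw [map_add, LinearMap.add_apply, h1, h2, map_add, smul_add, neg_add]
    | smul c x _ h => rw [map_smul, LinearMap.smul_apply, h, map_smul, smul_comm, smul_neg]
    | mem x h =>
      obtain ⟨x, hx, a, rfl⟩ := h
      induction hy using Submodule.span_induction with
      | zero => simp
      | add x x' _ _ h1 h2 =>
        rw [map_add, h1, h2, map_add, LinearMap.add_apply, smul_add, neg_add]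
      | smul c x _ h => rw [map_smul, h, map_smul, LinearMap.smul_apply, smul_comm, smul_neg]
      | mem y h =>
        obtain ⟨y, hy, b, rfl⟩ := h
        rw [mapBr_tmul, mapBr_tmul, br_skew hx hy, TensorProduct.neg_tmul, mul_comm,
          TensorProduct.smul_tmul']
  br_jacobi := by
    intro i j x y z hx hy
    induction hx using Submodule.span_induction with
    | zero => simp
    | add x x' _ _ h1 h2 =>
      simp only [map_add, LinearMap.add_apply, h1, h2, smul_add]; abel
    | smul c x _ h =>
      simp only [map_smul, LinearMap.smul_apply, h, smul_add]
      rw [smul_comm c (koszul i j)]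
    | mem x h =>
      obtain ⟨x, hx, a, rfl⟩ := h
      induction hy using Submodule.span_induction with
      | zero => simp
      | add x x' _ _ h1 h2 =>
        simp only [map_add, LinearMap.add_apply, h1, h2, smul_add]; abel
      | smul c x _ h =>
        simp only [map_smul, LinearMap.smul_apply, h, smul_add]
        rw [smul_comm c (koszul i j)]
      | mem y h =>
        obtain ⟨y, hy, b, rfl⟩ := h
        induction z with
        | zero => simp
        | add z z' h1 h2 => simp only [map_add, h1, h2, smul_add]; abel
        | tmul z c =>
          simp only [mapBr_tmul]
          rw [br_jacobi z hx hy, TensorProduct.add_tmul, TensorProduct.smul_tmul', mul_assoc,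
            mul_left_comm b a c]

/-- The inclusion `x ↦ x ⊗ 1` of `L` in `L ⊗ A`, on enveloping algebras. -/
def envMap (L : Type u) [AddCommGroup L] [Module ℂ L] [LieSuperalgebra L]
    (A : Type v) [CommRing A] [Algebra ℂ A] : Env L →ₐ[ℂ] Env (L ⊗[ℂ] A) :=
  Env.lift (Env.ι ∘ₗ (TensorProduct.mk ℂ L A).flip 1) (by
    intro i j x y hx hy
    have hx' : x ⊗ₜ[ℂ] (1 : A) ∈ parity (L := L ⊗[ℂ] A) i :=
      Submodule.subset_span ⟨x, hx, 1, rfl⟩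
    have hy' : y ⊗ₜ[ℂ] (1 : A) ∈ parity (L := L ⊗[ℂ] A) j :=
      Submodule.subset_span ⟨y, hy, 1, rfl⟩
    have h := Env.ι_br hx' hy'
    have hb : br (x ⊗ₜ[ℂ] (1 : A)) (y ⊗ₜ[ℂ] (1 : A)) = br x y ⊗ₜ[ℂ] (1 : A) := by
      change mapBr L A _ _ = _
      rw [mapBr_tmul, one_mul]
    rw [hb] at h
    simpa using h)

end MapSuper

/-! ### Extension of scalars along a map of noncommutative algebras -/

section ExtendScalars

variable {R S : Type*} [Ring R] [Algebra ℂ R] [Ring S] [Algebra ℂ S] (φ : R →ₐ[ℂ] S)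
  (V : Type*) [AddCommGroup V] [Module ℂ V] [Module R V]

/-- The `S`-submodule of `S ⊗_ℂ V` generated by the elements `s φ(r) ⊗ v - s ⊗ r v`. -/
def balancing : Submodule S (S ⊗[ℂ] V) :=
  Submodule.span S {z | ∃ (s : S) (r : R) (v : V),
    z = (s * φ r) ⊗ₜ[ℂ] v - s ⊗ₜ[ℂ] (r • v)}

/-- The left `S`-module `S ⊗_R V`, where `R` acts on the right of `S` through `φ`. -/
abbrev ExtendScalars := (S ⊗[ℂ] V) ⧸ balancing φ V

end ExtendScalars

/-! ### Cartan subalgebras, roots and simple systems -/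

section Roots

variable (L : Type u) [AddCommGroup L] [Module ℂ L] [LieSuperalgebra L]

/-- A Cartan subalgebra `h` of the even part of `L` together with a system of simple roots.

Roots are taken with respect to a torus `T` of commuting even derivations of `L` which contains the
inner derivations `[x, ·]` with `x ∈ h`, and whose space of invariants in `L` is `h`. For a basic
Lie superalgebra other than `A(n,n)`, all derivations are inner, so that `T` is the image of `h`
under the adjoint representation, and roots are linear forms on `h` in the usual way. For
`𝔰𝔩(n,n)` and its quotient `A(n-1,n-1)` by the centre, the simple roots are those of `𝔤𝔩(n,n)`, and
`T` is the image in the derivations of the Cartan subalgebra of `𝔤𝔩(n,n)`; the simple roots would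
be linearly dependent as linear forms on `h`. -/
structure SimpleSystem where
  h : Submodule ℂ L
  T : Submodule ℂ (Module.End ℂ L)
  T_even : ∀ t ∈ T, ∀ i, ∀ x ∈ parity (L := L) i, t x ∈ parity (L := L) i
  T_derivation : ∀ t ∈ T, ∀ x y, t (br x y) = br (t x) y + br x (t y)
  T_comm : ∀ s ∈ T, ∀ t ∈ T, s * t = t * s
  h_even : h ≤ parity 0
  ad_mem : ∀ x ∈ h, br x ∈ T
  mem_h_iff : ∀ x, x ∈ h ↔ ∀ t ∈ T, t x = 0
  /-- the number of simple roots -/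
  rank : ℕ
  /-- the simple roots -/
  root : Fin rank → Module.Dual ℂ T
  linearIndependent_root : LinearIndependent ℂ root
  /-- the simple root vectors -/
  X : Fin rank → L
  /-- the opposite simple root vectors -/
  Y : Fin rank → L
  X_ne_zero : ∀ i, X i ≠ 0
  /-- the parities of the simple roots -/
  p : Fin rank → ZMod 2
  X_mem : ∀ i, X i ∈ parity (L := L) (p i)
  Y_mem : ∀ i, Y i ∈ parity (L := L) (p i)
  X_root : ∀ i, ∀ t : T, t.1 (X i) = root i t • X i
  Y_root : ∀ i, ∀ t : T, t.1 (Y i) = -(root i t • Y i)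
  br_X_Y : ∀ i j, i ≠ j → br (X i) (Y j) = 0
  generates : lieSpan ((h : Set L) ∪ Set.range X ∪ Set.range Y) = ⊤

variable {L}

namespace SimpleSystem

variable (S : SimpleSystem L)

/-- The root space `L_α`, for a linear form `α` on the torus. -/
def rootSpace (α : Module.Dual ℂ S.T) : Submodule ℂ L where
  carrier := {x | ∀ t : S.T, t.1 x = α t • x}
  zero_mem' := by simp
  add_mem' := by
    intro x y hx hy t
    rw [map_add, hx t, hy t, smul_add]
  smul_mem' := by
    intro c x hx t
    rw [map_smul, hx t, smul_comm]

/-- The subalgebra `n⁺` generated by the simple root vectors. -/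
def nPos : Submodule ℂ L := lieSpan (Set.range S.X)

/-- The positive root lattice `Q⁺`: sums of simple roots with coefficients in `ℕ`. -/
def QPos : AddSubmonoid (Module.Dual ℂ S.T) := AddSubmonoid.closure (Set.range S.root)

/-- The set of positive even roots. -/
def evenPosRoots : Set (Module.Dual ℂ S.T) :=
  {α | α ≠ 0 ∧ S.rootSpace α ≠ ⊥ ∧ S.rootSpace α ≤ parity 0 ∧ α ∈ S.QPos}

/-- The simple roots of the even part of `L`: the positive even roots which are not sums of two
positive even roots. -/
def evenSimpleRoots : Set (Module.Dual ℂ S.T) :=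
  {α | α ∈ S.evenPosRoots ∧ ∀ β ∈ S.evenPosRoots, ∀ γ ∈ S.evenPosRoots, α ≠ β + γ}

/-- A choice of `𝔰𝔩(2)`-triples `X_α ∈ L_α`, `Y_α ∈ L_{-α}`, `H_α ∈ h`, where `α` ranges over the
simple roots of the even part. -/
structure EvenTriples where
  X : S.evenSimpleRoots → L
  Y : S.evenSimpleRoots → L
  H : S.evenSimpleRoots → S.h
  H_ne_zero : ∀ α, H α ≠ 0
  X_mem : ∀ α, X α ∈ S.rootSpace α.1
  Y_mem : ∀ α, Y α ∈ S.rootSpace (-α.1)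
  br_X_Y : ∀ α, br (X α) (Y α) = (H α : L)
  br_H_X : ∀ α, br (H α : L) (X α) = (2 : ℂ) • X α
  br_H_Y : ∀ α, br (H α : L) (Y α) = -((2 : ℂ) • Y α)

/-- `v` is a highest weight vector of weight `lam` in the `L`-module `V`. -/
def IsHighestWeightVector (lam : Module.Dual ℂ S.h) {V : Type*} [AddCommGroup V] [Module ℂ V]
    [Module (Env L) V] (v : V) : Prop :=
  v ≠ 0 ∧ (∀ x ∈ S.nPos, Env.ι x • v = 0) ∧ ∀ x : S.h, Env.ι (x : L) • v = lam x • v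

/-- The set `Λ⁺` of all weights `lam` for which the irreducible `L`-module of highest weight `lam`
is finite-dimensional. -/
def dominant : Set (Module.Dual ℂ S.h) :=
  {lam | ∃ (V : Type u) (_ : AddCommGroup V) (_ : Module ℂ V) (_ : Module (Env L) V)
    (_ : IsScalarTower ℂ (Env L) V), IsSimpleModule (Env L) V ∧ FiniteDimensional ℂ V ∧
      ∃ v : V, S.IsHighestWeightVector lam v}

variable {S} (E : S.EvenTriples) (lam : Module.Dual ℂ S.h)

/-! ### The modules -/

/-- The left ideal of `U(L)` generated by the relations `n⁺ v = 0`, `h v = lam(h) v` and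
`Y_α ^ (lam(H_α) + 1) v = 0` for the simple roots `α` of the even part. (If `lam` is in `Λ⁺`, then
`lam(H_α)` is a natural number `m`.) -/
def kacIdeal : Ideal (Env L) :=
  Ideal.span
    ({u | ∃ x ∈ S.nPos, u = Env.ι x} ∪
      {u | ∃ x : S.h, u = Env.ι (x : L) - algebraMap ℂ (Env L) (lam x)} ∪
      {u | ∃ (α : S.evenSimpleRoots) (m : ℕ), lam (E.H α) = (m : ℂ) ∧ u = Env.ι (E.Y α) ^ (m + 1)})

/-- The generalized Kac module, generated by `v_lam` with the relations listed above. -/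
abbrev KacModule : Type u := Env L ⧸ kacIdeal E lam

/-- The generator `v_lam` of the generalized Kac module. -/
def kacGen : KacModule E lam := Submodule.Quotient.mk 1

variable (A : Type v) [CommRing A] [Algebra ℂ A]

/-- The `L ⊗ A`-module `U(L ⊗ A) ⊗_{U(L)} V`. -/
abbrev Induced (L : Type u) [AddCommGroup L] [Module ℂ L] [LieSuperalgebra L]
    (A : Type v) [CommRing A] [Algebra ℂ A] (V : Type*) [AddCommGroup V] [Module ℂ V] [Module (Env L) V] :=
  ExtendScalars (envMap L A) V

/-- The element `1 ⊗ v_lam` of the module induced from the generalized Kac module. -/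
def inducedGen : Induced L A (KacModule E lam) :=
  Submodule.Quotient.mk (1 ⊗ₜ[ℂ] kacGen E lam)

variable (S) in
/-- The component of `U(L ⊗ A)` of weight `μ`: the span of the products
`(x₁ ⊗ a₁) ⋯ (x_k ⊗ a_k)` such that `x_i` is in the root space of `α_i` and `∑ α_i = μ`. -/
def envComponent (μ : Module.Dual ℂ S.T) : Submodule ℂ (Env (L ⊗[ℂ] A)) :=
  Submodule.span ℂ {u | ∃ l : List (Module.Dual ℂ S.T × L × A),
    (∀ q ∈ l, q.2.1 ∈ S.rootSpace q.1) ∧ (l.map fun q => q.1).sum = μ ∧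
    u = (l.map fun q => Env.ι (q.2.1 ⊗ₜ[ℂ] q.2.2)).prod}

variable (S) in
/-- For an `L ⊗ A`-module generated by a vector `v` of weight `lam`, the weight space of weight
`lam + μ`. If the torus consists of the inner derivations `[x, ·]` with `x ∈ h`, then this is the
space of weight vectors in the usual sense, see `mem_weightSpace_iff`. -/
def weightSpace {M : Type*} [AddCommGroup M] [Module (Env (L ⊗[ℂ] A)) M] (v : M)
    (μ : Module.Dual ℂ S.T) : Set M :=
  {m | ∃ u ∈ S.envComponent A μ, m = u • v}

variable (S) in
/-- For an `L ⊗ A`-module generated by a vector `v` of weight `lam`, the submodule generated by all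
the weight spaces for weights not in `lam - Q⁺`. -/
def truncationKernel {M : Type*} [AddCommGroup M] [Module (Env (L ⊗[ℂ] A)) M] (v : M) :
    Submodule (Env (L ⊗[ℂ] A)) M :=
  Submodule.span _ (⋃ μ ∈ {μ : Module.Dual ℂ S.T | -μ ∉ S.QPos}, S.weightSpace A v μ)

/-- The global Weyl module: the largest quotient of the module induced from the generalized Kac
module whose weights are in `lam - Q⁺`. -/
abbrev GlobalWeyl := Induced L A (KacModule E lam) ⧸ S.truncationKernel A (inducedGen E lam A)

/-- The image `w_lam` of `v_lam` in the global Weyl module. -/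
def weylGen : GlobalWeyl E lam A := Submodule.Quotient.mk (inducedGen E lam A)

/-- The left ideal of `U(L ⊗ A)` generated by the relations `(n⁺ ⊗ A) w = 0`, `h w = lam(h) w` and
`Y_α ^ (lam(H_α) + 1) w = 0` for the simple roots `α` of the even part. -/
def weylIdeal : Ideal (Env (L ⊗[ℂ] A)) :=
  Ideal.span
    ({u | ∃ x ∈ S.nPos, ∃ a : A, u = Env.ι (x ⊗ₜ[ℂ] a)} ∪
      {u | ∃ x : S.h, u = Env.ι ((x : L) ⊗ₜ[ℂ] (1 : A)) - algebraMap ℂ _ (lam x)} ∪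
      {u | ∃ (α : S.evenSimpleRoots) (m : ℕ), lam (E.H α) = (m : ℂ) ∧
        u = Env.ι (E.Y α ⊗ₜ[ℂ] (1 : A)) ^ (m + 1)})

/-! ### Weight spaces in the usual sense -/

lemma br_rootSpace {α β : Module.Dual ℂ S.T} {x y : L} (hx : x ∈ S.rootSpace α)
    (hy : y ∈ S.rootSpace β) : br x y ∈ S.rootSpace (α + β) := by
  intro t
  rw [S.T_derivation t.1 t.2, hx t, hy t]
  simp [add_smul]

variable (S) in
lemma iSup_rootSpace : ⨆ α, S.rootSpace α = ⊤ := by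
  rw [eq_top_iff, ← S.generates]
  refine sInf_le ⟨?_, ?_⟩
  · rintro x ((hx | ⟨i, rfl⟩) | ⟨i, rfl⟩)
    · refine Submodule.mem_iSup_of_mem 0 fun t => ?_
      simpa using (S.mem_h_iff x).1 hx t.1 t.2
    · exact Submodule.mem_iSup_of_mem (S.root i) (S.X_root i)
    · refine Submodule.mem_iSup_of_mem (-S.root i) fun t => ?_
      simpa using S.Y_root i t
  · intro x hx y hy
    induction hx using Submodule.iSup_induction' with
    | zero => simp
    | add x x' _ _ h1 h2 => rw [map_add, LinearMap.add_apply]; exact add_mem h1 h2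
    | mem α x hx =>
      induction hy using Submodule.iSup_induction' with
      | zero => simp
      | add x x' _ _ h1 h2 => rw [map_add]; exact add_mem h1 h2
      | mem β y hy => exact Submodule.mem_iSup_of_mem _ (br_rootSpace hx hy)

lemma envComponent_mul {μ ν : Module.Dual ℂ S.T} {x y : Env (L ⊗[ℂ] A)}
    (hx : x ∈ S.envComponent A μ) (hy : y ∈ S.envComponent A ν) :
    x * y ∈ S.envComponent A (μ + ν) := by
  induction hx using Submodule.span_induction with
  | zero => simp
  | add x x' _ _ h1 h2 => rw [add_mul]; exact add_mem h1 h2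
  | smul c x _ h => rw [smul_mul_assoc]; exact Submodule.smul_mem _ _ h
  | mem x h =>
    induction hy using Submodule.span_induction with
    | zero => simp
    | add x x' _ _ h1 h2 => rw [mul_add]; exact add_mem h1 h2
    | smul c x _ h => rw [mul_smul_comm]; exact Submodule.smul_mem _ _ h
    | mem y h' =>
      obtain ⟨l, hl, rfl, rfl⟩ := h
      obtain ⟨l', hl', rfl, rfl⟩ := h'
      refine Submodule.subset_span ⟨l ++ l', ?_, by simp, by simp⟩
      intro q hq
      rcases List.mem_append.1 hq with hq | hq
      exacts [hl q hq, hl' q hq]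

variable (S) in
lemma iSup_envComponent : ⨆ μ, S.envComponent A μ = ⊤ := by
  rw [eq_top_iff]
  rintro u -
  obtain ⟨w, rfl⟩ := RingQuot.mkAlgHom_surjective ℂ (EnvRel (L ⊗[ℂ] A)) u
  induction w using TensorAlgebra.induction with
  | algebraMap c =>
    rw [AlgHom.commutes, Algebra.algebraMap_eq_smul_one]
    refine Submodule.smul_mem _ _ (Submodule.mem_iSup_of_mem 0 (Submodule.subset_span ?_))
    exact ⟨[], by simp, by simp, by simp⟩
  | ι z =>
    change Env.ι z ∈ _
    induction z with
    | zero => simp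
    | add x y hx hy => rw [map_add]; exact add_mem hx hy
    | tmul x a =>
      have hx : x ∈ ⨆ α, S.rootSpace α := by rw [S.iSup_rootSpace]; exact Submodule.mem_top
      induction hx using Submodule.iSup_induction' with
      | zero => simp
      | add x x' _ _ h1 h2 => rw [TensorProduct.add_tmul, map_add]; exact add_mem h1 h2
      | mem α x hx =>
        refine Submodule.mem_iSup_of_mem α (Submodule.subset_span ⟨[(α, x, a)], ?_, ?_, ?_⟩)
        · simpa using hx
        · simp
        · simp
  | mul x y hx hy =>
    rw [map_mul]
    generalize RingQuot.mkAlgHom ℂ (EnvRel (L ⊗[ℂ] A)) x = x' at *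
    generalize RingQuot.mkAlgHom ℂ (EnvRel (L ⊗[ℂ] A)) y = y' at *
    induction hx using Submodule.iSup_induction' with
    | zero => simp
    | add x x' _ _ h1 h2 => rw [add_mul]; exact add_mem h1 h2
    | mem α x hx =>
      induction hy using Submodule.iSup_induction' with
      | zero => simp
      | add x x' _ _ h1 h2 => rw [mul_add]; exact add_mem h1 h2
      | mem β y hy => exact Submodule.mem_iSup_of_mem _ (envComponent_mul A hx hy)
  | add x y hx hy => rw [map_add]; exact add_mem hx hy

/-- An element of `h` commutes with `L ⊗ A` as it does in an ordinary Lie algebra. -/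
lemma h_mul_ι (x : S.h) (y : L) (a : A) :
    Env.ι ((x : L) ⊗ₜ[ℂ] (1 : A)) * Env.ι (y ⊗ₜ[ℂ] a) =
      Env.ι (y ⊗ₜ[ℂ] a) * Env.ι ((x : L) ⊗ₜ[ℂ] (1 : A)) + Env.ι (br (x : L) y ⊗ₜ[ℂ] a) := by
  have hx' : (x : L) ⊗ₜ[ℂ] (1 : A) ∈ parity (L := L ⊗[ℂ] A) 0 :=
    Submodule.subset_span ⟨x, S.h_even x.2, 1, rfl⟩
  have key : ∀ (j : ZMod 2) (y : L), y ∈ parity (L := L) j →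
      Env.ι ((x : L) ⊗ₜ[ℂ] (1 : A)) * Env.ι (y ⊗ₜ[ℂ] a) =
      Env.ι (y ⊗ₜ[ℂ] a) * Env.ι ((x : L) ⊗ₜ[ℂ] (1 : A)) + Env.ι (br (x : L) y ⊗ₜ[ℂ] a) := by
    intro j y hy
    have hy' : y ⊗ₜ[ℂ] a ∈ parity (L := L ⊗[ℂ] A) j := Submodule.subset_span ⟨y, hy, a, rfl⟩
    have h := Env.ι_br hx' hy'
    have hb : br ((x : L) ⊗ₜ[ℂ] (1 : A)) (y ⊗ₜ[ℂ] a) = br (x : L) y ⊗ₜ[ℂ] a := by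
      change mapBr L A _ _ = _
      rw [mapBr_tmul, one_mul]
    rw [hb] at h
    rw [← h]
    simp [koszul]
  have hy : y ∈ parity (L := L) 0 ⊔ parity 1 := by
    rw [(isCompl_parity (L := L)).sup_eq_top]; exact Submodule.mem_top
  obtain ⟨y0, h0, y1, h1, rfl⟩ := Submodule.mem_sup.1 hy
  simp only [TensorProduct.add_tmul, map_add, mul_add, add_mul, key 0 y0 h0, key 1 y1 h1]
  abel

/-- `h` acts by the weight `lam + μ` on the weight space of weight `lam + μ`. -/
lemma h_smul_of_mem_envComponent {M : Type*} [AddCommGroup M] [Module ℂ M]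
    [Module (Env (L ⊗[ℂ] A)) M] [IsScalarTower ℂ (Env (L ⊗[ℂ] A)) M] {v : M}
    (hv : ∀ x : S.h, Env.ι ((x : L) ⊗ₜ[ℂ] (1 : A)) • v = lam x • v)
    {μ : Module.Dual ℂ S.T} {u : Env (L ⊗[ℂ] A)} (hu : u ∈ S.envComponent A μ) (x : S.h) :
    Env.ι ((x : L) ⊗ₜ[ℂ] (1 : A)) • u • v =
      (lam x + μ ⟨br (x : L), S.ad_mem x x.2⟩) • u • v := by
  induction hu using Submodule.span_induction with
  | zero => simp
  | add x x' _ _ h1 h2 => rw [add_smul, smul_add, h1, h2, smul_add]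
  | smul c w _ h =>
    rw [smul_assoc, ← algebraMap_smul (Env (L ⊗[ℂ] A)) c (w • v), smul_smul,
      ← Algebra.commutes, ← smul_smul, h, algebraMap_smul, algebraMap_smul, smul_comm]
  | mem u h =>
    obtain ⟨l, hl, rfl, rfl⟩ := h
    induction l with
    | nil => simpa using hv x
    | cons q l ih =>
      have hq := hl q (by simp) ⟨br (x : L), S.ad_mem x x.2⟩
      specialize ih fun q hq => hl q (by simp [hq])
      simp only [List.map_cons, List.prod_cons, List.sum_cons, mul_smul]
      rw [← mul_smul, h_mul_ι, add_smul, mul_smul, ih]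
      simp only at hq
      rw [hq, ← TensorProduct.smul_tmul', map_smul, smul_assoc]
      rw [← algebraMap_smul (Env (L ⊗[ℂ] A)) (lam x + _) ((List.prod _) • v), smul_smul,
        ← Algebra.commutes, ← smul_smul, algebraMap_smul, ← add_smul, LinearMap.add_apply]
      congr 1
      ring

/-- If the torus consists of the inner derivations `[x, ·]` with `x ∈ h`, then the weight spaces
defined above are the weight spaces in the usual sense, i.e. the joint eigenspaces of `h`. -/
theorem mem_weightSpace_iff (hT : ∀ t ∈ S.T, ∃ x ∈ S.h, t = br x)
    {M : Type*} [AddCommGroup M] [Module ℂ M]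
    [Module (Env (L ⊗[ℂ] A)) M] [IsScalarTower ℂ (Env (L ⊗[ℂ] A)) M] {v : M}
    (hspan : Submodule.span (Env (L ⊗[ℂ] A)) {v} = ⊤)
    (hv : ∀ x : S.h, Env.ι ((x : L) ⊗ₜ[ℂ] (1 : A)) • v = lam x • v)
    (μ : Module.Dual ℂ S.T) (m : M) :
    m ∈ S.weightSpace A v μ ↔ ∀ x : S.h, Env.ι ((x : L) ⊗ₜ[ℂ] (1 : A)) • m =
      (lam x + μ ⟨br (x : L), S.ad_mem x x.2⟩) • m := by
  constructor
  · rintro ⟨u, hu, rfl⟩ x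
    exact h_smul_of_mem_envComponent lam A hv hu x
  intro hm
  let f : S.h → Module.End ℂ M := fun x =>
    Algebra.lsmul ℂ ℂ M (Env.ι ((x : L) ⊗ₜ[ℂ] (1 : A)))
  have hcomm : ∀ x y, Commute (f x) (f y) := by
    intro x y
    refine Commute.map (f := Algebra.lsmul ℂ ℂ M) ?_
    have h0 : br (x : L) (y : L) = 0 := (S.mem_h_iff y).1 y.2 _ (S.ad_mem x x.2)
    have h := h_mul_ι A x (y : L) (1 : A)
    rw [h0] at h
    rw [commute_iff_eq]
    simpa using h
  let W : (S.h → ℂ) → Submodule ℂ M := fun χ => ⨅ x, (f x).maxGenEigenspace (χ x)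
  have hind : iSupIndep W := Module.End.independent_iInf_maxGenEigenspace_of_forall_mapsTo f
    fun i j φ => Module.End.mapsTo_maxGenEigenspace_of_comm (hcomm j i) φ
  let wt : Module.Dual ℂ S.T → S.h → ℂ := fun ν x => lam x + ν ⟨br (x : L), S.ad_mem x x.2⟩
  have hinj : Function.Injective wt := by
    intro ν ν' h
    ext ⟨t, ht⟩
    obtain ⟨x, hx, rfl⟩ := hT t ht
    have := congrFun h ⟨x, hx⟩
    simpa [wt] using this
  have hW : ∀ (ν : Module.Dual ℂ S.T) (m : M),
      (∀ x : S.h, Env.ι ((x : L) ⊗ₜ[ℂ] (1 : A)) • m = wt ν x • m) → m ∈ W (wt ν) := by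
    intro ν m h
    rw [Submodule.mem_iInf]
    intro x
    refine Module.End.mem_maxGenEigenspace _ _ _ |>.2 ⟨1, ?_⟩
    simp only [pow_one, LinearMap.sub_apply, LinearMap.smul_apply, Module.End.one_apply, f,
      Algebra.lsmul_coe]
    rw [h x, sub_self]
  have hind' : iSupIndep fun ν => W (wt ν) := hind.comp hinj
  obtain ⟨u, rfl⟩ := Submodule.mem_span_singleton.1
    (show m ∈ Submodule.span (Env (L ⊗[ℂ] A)) {v} by rw [hspan]; exact Submodule.mem_top)
  have hu : u ∈ ⨆ ν, S.envComponent A ν := by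
    rw [S.iSup_envComponent]; exact Submodule.mem_top
  have hdec : ∃ u0 ∈ S.envComponent A μ, ∃ z ∈ ⨆ ν, ⨆ (_ : ν ≠ μ), W (wt ν),
      u • v = u0 • v + z := by
    clear hm
    induction hu using Submodule.iSup_induction' with
    | zero => exact ⟨0, zero_mem _, 0, zero_mem _, by simp⟩
    | add x y _ _ h1 h2 =>
      obtain ⟨a, ha, z, hz, e⟩ := h1
      obtain ⟨a', ha', z', hz', e'⟩ := h2
      exact ⟨a + a', add_mem ha ha', z + z', add_mem hz hz', by
        rw [add_smul, add_smul, e, e']; abel⟩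
    | mem ν u hu =>
      by_cases h : ν = μ
      · subst h
        exact ⟨u, hu, 0, zero_mem _, by simp⟩
      · refine ⟨0, zero_mem _, u • v, ?_, by simp⟩
        exact Submodule.mem_iSup_of_mem ν (Submodule.mem_iSup_of_mem h
          (hW ν _ fun x => h_smul_of_mem_envComponent lam A hv hu x))
  obtain ⟨u0, h0, z, hz, e⟩ := hdec
  have hzW : z ∈ W (wt μ) := by
    have : z = u • v - u0 • v := by rw [e]; abel
    rw [this]
    exact sub_mem (hW μ _ hm) (hW μ _ fun x => h_smul_of_mem_envComponent lam A hv h0 x)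
  have hz0 : z = 0 := Submodule.disjoint_def.1 (hind' μ) z hzW hz
  exact ⟨u0, h0, by rw [e, hz0, add_zero]⟩

end SimpleSystem

end Roots

end SuperWeyl

open scoped TensorProduct

noncomputable section

namespace SuperWeyl

open LieSuperalgebra

/-! ### Triangular decomposition and the weights of `n⁺`. -/

section Triangular

variable {L : Type*} [AddCommGroup L] [Module ℂ L] [LieSuperalgebra L]

/-! Both modules are cyclic, so the claim is that the annihilator of `w_λ` is exactly the left ideal
`J` given by the relations.

The relations hold in `W(λ)`: those for `h` and `Y_α` come from the generalized Kac module. As for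
`n⁺ ⊗ A`, its weights are nonzero elements of `Q⁺`; since the simple roots are linearly independent,
none of them lies in `-Q⁺`, so `n⁺ ⊗ A` sends `w_λ` into the truncated weight spaces
(`ι_mem_iSup_envComponent`).

Conversely, the relations of the Kac module hold in `U(𝔤 ⊗ A)/J`, so the universal property of
induction gives a map from `P` to it. This map must kill the weight spaces outside `λ - Q⁺`, that
is, the component of `U(𝔤 ⊗ A)` of weight `μ` must lie in `J` when `μ ∉ -Q⁺`
(`envComponent_le_of_nPos_mem`). By the triangular decomposition, a root vector whose weight is not
in `-Q⁺` lies in `n⁺` (`rootSpace_le_nPos`). Supercommuting such factors to the right, where they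
fall into `J`, leaves products of factors with weights in `-Q⁺`, and these have total weight in
`-Q⁺` (`prod_mem_sup_nonposComponent`). The induced map `W(λ) → U(𝔤 ⊗ A)/J` sends `u w_λ` to the
class of `u`, so the annihilator is no larger than `J`. -/

lemma exists_parity_decomposition (x : L) :
    ∃ y ∈ parity (L := L) 0, ∃ z ∈ parity (L := L) 1, x = y + z := by
  have hx : x ∈ parity (L := L) 0 ⊔ parity 1 := by
    rw [(isCompl_parity (L := L)).sup_eq_top]; exact Submodule.mem_top
  obtain ⟨y, hy, z, hz, rfl⟩ := Submodule.mem_sup.1 hx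
  exact ⟨y, hy, z, hz, rfl⟩

lemma subset_lieSpan (s : Set L) : s ⊆ lieSpan s := fun _ hx =>
  Submodule.mem_sInf.2 fun _ hp => hp.1 hx

lemma br_mem_lieSpan {s : Set L} {x y : L} (hx : x ∈ lieSpan s) (hy : y ∈ lieSpan s) :
    br x y ∈ lieSpan s :=
  Submodule.mem_sInf.2 fun p hp =>
    hp.2 x (Submodule.mem_sInf.1 hx p hp) y (Submodule.mem_sInf.1 hy p hp)

lemma lieSpan_le {s : Set L} {p : Submodule ℂ L} (hs : s ⊆ p)
    (hp : ∀ x ∈ p, ∀ y ∈ p, br x y ∈ p) : lieSpan s ≤ p :=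
  sInf_le ⟨hs, hp⟩

/-- The iterated brackets `[X i₁, [X i₂, …, [X i_k, X j]]]`. -/
inductive IteratedBracket {ι : Type*} (X : ι → L) : L → Prop
  | of (i : ι) : IteratedBracket X (X i)
  | br (i : ι) {x : L} : IteratedBracket X x → IteratedBracket X (br (X i) x)

/-- The span of all iterated brackets of the elements of a family. -/
def iteratedSpan {ι : Type*} (X : ι → L) : Submodule ℂ L :=
  Submodule.span ℂ {x | IteratedBracket X x}

lemma mem_iteratedSpan {ι : Type*} (X : ι → L) (i : ι) : X i ∈ iteratedSpan X :=
  Submodule.subset_span (.of i)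

lemma br_mem_iteratedSpan {ι : Type*} (X : ι → L) (i : ι) {x : L} (hx : x ∈ iteratedSpan X) :
    br (X i) x ∈ iteratedSpan X := by
  induction hx using Submodule.span_induction with
  | zero => simp
  | add x y _ _ h1 h2 => rw [map_add]; exact add_mem h1 h2
  | smul c x _ h => rw [map_smul]; exact Submodule.smul_mem _ _ h
  | mem x h => exact Submodule.subset_span (.br i h)

/-- Leibniz rule, each generator being an eigenvector. Applied to `ad z` for `z ∈ h`, it shows that
`h` normalizes both nilpotent parts. -/
lemma derivation_iteratedSpan {ι : Type*} {X : ι → L} {d : Module.End ℂ L}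
    (hd : ∀ x y, d (br x y) = br (d x) y + br x (d y)) {c : ι → ℂ} (hX : ∀ i, d (X i) = c i • X i)
    {x : L} (hx : x ∈ iteratedSpan X) : d x ∈ iteratedSpan X := by
  induction hx using Submodule.span_induction with
  | zero => simp
  | add x y _ _ h1 h2 => rw [map_add]; exact add_mem h1 h2
  | smul c x _ h => rw [map_smul]; exact Submodule.smul_mem _ _ h
  | mem x h =>
    induction h with
    | of i => rw [hX]; exact Submodule.smul_mem _ _ (mem_iteratedSpan X i)
    | br i h ih =>
      rw [hd, hX, map_smul, LinearMap.smul_apply]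
      exact add_mem (Submodule.smul_mem _ _ (br_mem_iteratedSpan X i (Submodule.subset_span h)))
        (br_mem_iteratedSpan X i ih)

/-- If the homogeneous elements `X i` and `Y i` have their mixed brackets in a space `h` which
normalizes the iterated brackets of the `X i`, then bracketing with `Y i` maps the iterated brackets
of the `X i` to `h` or to iterated brackets. -/
lemma br_mem_sup_iteratedSpan {ι : Type*} {X Y : ι → L} {p : ι → ZMod 2} {h : Submodule ℂ L}
    (hX : ∀ i, X i ∈ parity (L := L) (p i)) (hY : ∀ i, Y i ∈ parity (L := L) (p i))
    (hXY : ∀ i j, br (Y i) (X j) ∈ h)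
    (hn : ∀ z ∈ h, ∀ x ∈ iteratedSpan X, br z x ∈ iteratedSpan X)
    (hn' : ∀ z ∈ h, ∀ i, br (X i) z ∈ iteratedSpan X)
    (i : ι) {x : L} (hx : x ∈ iteratedSpan X) : br (Y i) x ∈ h ⊔ iteratedSpan X := by
  induction hx using Submodule.span_induction with
  | zero => simp
  | add x y _ _ h1 h2 => rw [map_add]; exact add_mem h1 h2
  | smul c x _ h => rw [map_smul]; exact Submodule.smul_mem _ _ h
  | mem x h =>
    induction h with
    | of j => exact Submodule.mem_sup_left (hXY i j)
    | br j hx ih =>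
      -- The first Jacobi term is an element of `h` acting on an iterated bracket. In the second,
      -- `[Y i, x]` lies in `h ⊔ iteratedSpan X` by induction, and `[X j, ·]` sends both summands
      -- into `iteratedSpan X`.
      rw [br_jacobi _ (hY i) (hX j)]
      refine add_mem (Submodule.mem_sup_right (hn _ (hXY i j) _ (Submodule.subset_span hx)))
        (Submodule.smul_mem _ _ (Submodule.mem_sup_right ?_))
      obtain ⟨z, hz, y, hy, e⟩ := Submodule.mem_sup.1 ih
      rw [← e, map_add]
      exact add_mem (hn' z hz j) (br_mem_iteratedSpan X j hy)

/-- A subspace which is stable under bracketing with the homogeneous elements of a set is stable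
under bracketing with the subalgebra generated by the set. -/
lemma br_mem_of_mem_lieSpan {s : Set L} {P : Submodule ℂ L}
    (hs : ∀ x ∈ s, ∃ i, x ∈ parity (L := L) i) (hP : ∀ x ∈ s, ∀ y ∈ P, br x y ∈ P)
    {x : L} (hx : x ∈ lieSpan s) {y : L} (hy : y ∈ P) : br x y ∈ P := by
  let N : Submodule ℂ L :=
    { carrier := {x | ∀ y ∈ P, br x y ∈ P}
      zero_mem' := by simp
      add_mem' := by
        intro a b ha hb y hy
        rw [map_add]
        exact add_mem (ha y hy) (hb y hy)
      smul_mem' := by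
        intro c a ha y hy
        rw [map_smul]
        exact Submodule.smul_mem _ _ (ha y hy) }
  have hbr : ∀ i j, ∀ a ∈ N ⊓ parity i, ∀ b ∈ N ⊓ parity j, br a b ∈ N ⊓ parity (i + j) := by
    intro i j a ha b hb
    refine ⟨fun y hy => ?_, br_mem ha.2 hb.2⟩
    have h := br_jacobi y ha.2 hb.2
    rw [← sub_eq_iff_eq_add] at h
    rw [← h]
    exact sub_mem (ha.1 _ (hb.1 _ hy)) (Submodule.smul_mem _ _ (hb.1 _ (ha.1 _ hy)))
  -- The Jacobi identity is available for homogeneous elements only, and `N` need not be graded. The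
  -- sum of the homogeneous parts of `N` is closed under the bracket and still contains `s`.
  have hle : lieSpan s ≤ ⨆ i, N ⊓ parity i := by
    refine lieSpan_le ?_ ?_
    · intro x hx
      obtain ⟨i, hi⟩ := hs x hx
      exact Submodule.mem_iSup_of_mem i ⟨hP x hx, hi⟩
    · intro a ha b hb
      induction ha using Submodule.iSup_induction' with
      | zero => simp
      | add x x' _ _ h1 h2 => rw [map_add, LinearMap.add_apply]; exact add_mem h1 h2
      | mem i a ha =>
        induction hb using Submodule.iSup_induction' with
        | zero => simp
        | add x x' _ _ h1 h2 => rw [map_add]; exact add_mem h1 h2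
        | mem j b hb => exact Submodule.mem_iSup_of_mem _ (hbr i j a ha b hb)
  exact (hle.trans (iSup_le fun i => inf_le_left) hx) y hy

namespace SimpleSystem

variable (S : SimpleSystem L)

lemma mem_h_iff_mem_rootSpace_zero {x : L} : x ∈ S.h ↔ x ∈ S.rootSpace 0 := by
  rw [S.mem_h_iff]
  exact ⟨fun h t => by simpa using h t.1 t.2, fun h t ht => by simpa using h ⟨t, ht⟩⟩

lemma br_h {x : L} (hx : x ∈ S.h) {α : Module.Dual ℂ S.T} {y : L} (hy : y ∈ S.rootSpace α) :
    br x y = α ⟨br x, S.ad_mem x hx⟩ • y :=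
  hy ⟨br x, S.ad_mem x hx⟩

lemma exists_br_h_right {x : L} (hx : x ∈ S.h) {j : ZMod 2} {α : Module.Dual ℂ S.T} {y : L}
    (hy : y ∈ S.rootSpace α) (hj : y ∈ parity (L := L) j) : ∃ c : ℂ, br y x = c • y := by
  refine ⟨-(koszul j 0 * α ⟨br x, S.ad_mem x hx⟩), ?_⟩
  rw [br_skew hj (S.h_even hx), S.br_h hx hy, smul_smul, neg_smul]

lemma X_mem_rootSpace (i : Fin S.rank) : S.X i ∈ S.rootSpace (S.root i) := S.X_root i

lemma Y_mem_rootSpace (i : Fin S.rank) : S.Y i ∈ S.rootSpace (-S.root i) := fun t => by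
  simpa using S.Y_root i t

/-- For `i = j` the bracket has weight zero, and the zero weight space of the torus is `h`. -/
lemma br_X_Y_mem (i j : Fin S.rank) : br (S.X i) (S.Y j) ∈ S.h := by
  by_cases hij : i = j
  · subst hij
    rw [S.mem_h_iff_mem_rootSpace_zero, ← add_neg_cancel (S.root i)]
    exact br_rootSpace (S.X_mem_rootSpace i) (S.Y_mem_rootSpace i)
  · rw [S.br_X_Y i j hij]
    exact zero_mem _

lemma br_Y_X_mem (i j : Fin S.rank) : br (S.Y i) (S.X j) ∈ S.h := by
  rw [br_skew (S.Y_mem i) (S.X_mem j)]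
  exact neg_mem (Submodule.smul_mem _ _ (S.br_X_Y_mem j i))

/-- The triangular decomposition `L = n⁻ + h + n⁺`. -/
lemma iteratedSpan_sup_eq_top : iteratedSpan S.Y ⊔ S.h ⊔ iteratedSpan S.X = ⊤ := by
  set P := iteratedSpan S.Y ⊔ S.h ⊔ iteratedSpan S.X
  have leY : iteratedSpan S.Y ≤ P := le_sup_left.trans le_sup_left
  have leh : S.h ≤ P := le_sup_right.trans le_sup_left
  have leX : iteratedSpan S.X ≤ P := le_sup_right
  have hnX : ∀ z ∈ S.h, ∀ x ∈ iteratedSpan S.X, br z x ∈ iteratedSpan S.X := fun z hz x hx =>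
    derivation_iteratedSpan (S.T_derivation _ (S.ad_mem z hz))
      (fun i => S.br_h hz (S.X_mem_rootSpace i)) hx
  have hnY : ∀ z ∈ S.h, ∀ x ∈ iteratedSpan S.Y, br z x ∈ iteratedSpan S.Y := fun z hz x hx =>
    derivation_iteratedSpan (S.T_derivation _ (S.ad_mem z hz))
      (fun i => S.br_h hz (S.Y_mem_rootSpace i)) hx
  have hXn : ∀ z ∈ S.h, ∀ i, br (S.X i) z ∈ iteratedSpan S.X := fun z hz i => by
    obtain ⟨c, hc⟩ := S.exists_br_h_right hz (S.X_mem_rootSpace i) (S.X_mem i)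
    rw [hc]
    exact Submodule.smul_mem _ _ (mem_iteratedSpan _ i)
  have hYn : ∀ z ∈ S.h, ∀ i, br (S.Y i) z ∈ iteratedSpan S.Y := fun z hz i => by
    obtain ⟨c, hc⟩ := S.exists_br_h_right hz (S.Y_mem_rootSpace i) (S.Y_mem i)
    rw [hc]
    exact Submodule.smul_mem _ _ (mem_iteratedSpan _ i)
  have hgen : ∀ x ∈ (S.h : Set L) ∪ Set.range S.X ∪ Set.range S.Y, ∀ y ∈ P, br x y ∈ P := by
    intro x hx y hy
    obtain ⟨y', hy', y₃, h₃, rfl⟩ := Submodule.mem_sup.1 hy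
    obtain ⟨y₁, h₁, y₂, h₂, rfl⟩ := Submodule.mem_sup.1 hy'
    rw [map_add, map_add]
    rcases hx with (hx | ⟨i, rfl⟩) | ⟨i, rfl⟩
    · refine add_mem (add_mem (leY (hnY x hx _ h₁)) ?_) (leX (hnX x hx _ h₃))
      rw [(S.mem_h_iff y₂).1 h₂ _ (S.ad_mem x hx)]
      exact zero_mem _
    · exact add_mem (add_mem
        (sup_le leh leY (br_mem_sup_iteratedSpan S.Y_mem S.X_mem S.br_X_Y_mem hnY hYn i h₁))
        (leX (hXn _ h₂ i))) (leX (br_mem_iteratedSpan _ i h₃))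
    · exact add_mem (add_mem (leY (br_mem_iteratedSpan _ i h₁)) (leY (hYn _ h₂ i)))
        (sup_le leh leX (br_mem_sup_iteratedSpan S.X_mem S.Y_mem S.br_Y_X_mem hnX hXn i h₃))
  have hpar : ∀ x ∈ (S.h : Set L) ∪ Set.range S.X ∪ Set.range S.Y,
      ∃ i, x ∈ parity (L := L) i := by
    rintro x ((hx | ⟨i, rfl⟩) | ⟨i, rfl⟩)
    exacts [⟨0, S.h_even hx⟩, ⟨_, S.X_mem i⟩, ⟨_, S.Y_mem i⟩]
  rw [eq_top_iff, ← S.generates]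
  refine lieSpan_le ?_ ?_
  · rintro x ((hx | ⟨i, rfl⟩) | ⟨i, rfl⟩)
    exacts [leh hx, leX (mem_iteratedSpan _ i), leY (mem_iteratedSpan _ i)]
  -- Stability under brackets with the generators gives stability under all of `L`, so `P` is in
  -- particular a subalgebra.
  · intro x _ y hy
    refine br_mem_of_mem_lieSpan hpar hgen ?_ hy
    rw [S.generates]
    exact Submodule.mem_top

/-- Root spaces are joint eigenspaces of the commuting family `T`, and distinct linear forms give
distinct systems of eigenvalues. -/
lemma iSupIndep_rootSpace : iSupIndep S.rootSpace := by
  let f : S.T → Module.End ℂ L := fun t => t.1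
  have hind : iSupIndep fun χ : S.T → ℂ => ⨅ t, (f t).maxGenEigenspace (χ t) :=
    Module.End.independent_iInf_maxGenEigenspace_of_forall_mapsTo f
      fun i j φ => Module.End.mapsTo_maxGenEigenspace_of_comm (S.T_comm _ j.2 _ i.2) φ
  have hinj : Function.Injective fun (α : Module.Dual ℂ S.T) (t : S.T) => α t :=
    DFunLike.coe_injective
  refine (hind.comp hinj).mono fun α x hx => ?_
  refine (Submodule.mem_iInf _).2 fun t => Module.End.mem_maxGenEigenspace _ _ _ |>.2 ⟨1, ?_⟩
  simp [f, hx t]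

/-- A family of subspaces of the members of an independent family with the same supremum is equal
to it. -/
lemma _root_.iSupIndep.eq_of_le_of_iSup_eq_top {ι R M : Type*} [Ring R] [AddCommGroup M]
    [Module R M] {p q : ι → Submodule R M} (hp : iSupIndep p) (hqp : ∀ i, q i ≤ p i)
    (hq : ⨆ i, q i = ⊤) (i : ι) : q i = p i := by
  refine le_antisymm (hqp i) fun x hx => ?_
  have hle : ⨆ i, q i ≤ q i ⊔ ⨆ j, ⨆ (_ : j ≠ i), p j := by
    refine iSup_le fun j => ?_
    by_cases h : j = i
    · subst h
      exact le_sup_left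
    · exact (hqp j).trans (le_sup_of_le_right (le_iSup₂_of_le j h le_rfl))
  obtain ⟨y, hy, z, hz, rfl⟩ := Submodule.mem_sup.1 (hle (hq ▸ Submodule.mem_top : x ∈ _))
  have hz' : z ∈ p i := by simpa using sub_mem hx (hqp i hy)
  rw [Submodule.disjoint_def.1 (hp i) z hz' hz, add_zero]
  exact hy

lemma root_mem_QPos (i : Fin S.rank) : S.root i ∈ S.QPos :=
  AddSubmonoid.subset_closure ⟨i, rfl⟩

lemma exists_of_mem_QPos {α : Module.Dual ℂ S.T} (hα : α ∈ S.QPos) :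
    ∃ c : Fin S.rank → ℕ, α = ∑ i, (c i : ℂ) • S.root i := by
  induction hα using AddSubmonoid.closure_induction with
  | zero => exact ⟨0, by simp⟩
  | mem x hx =>
    obtain ⟨i, rfl⟩ := hx
    exact ⟨Pi.single i 1, by simp [Pi.single_apply]⟩
  | add x y _ _ hx hy =>
    obtain ⟨c, rfl⟩ := hx
    obtain ⟨d, rfl⟩ := hy
    exact ⟨c + d, by simp [add_smul, Finset.sum_add_distrib]⟩

/-- The cone `Q⁺` is pointed because the simple roots are linearly independent. This is the reason
for measuring roots on `T`: for `𝔰𝔩(n,n)` they become dependent on `h`. -/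
lemma eq_zero_of_add_eq_zero {α β : Module.Dual ℂ S.T} (hα : α ∈ S.QPos) (hβ : β ∈ S.QPos)
    (h : α + β = 0) : α = 0 := by
  obtain ⟨c, rfl⟩ := S.exists_of_mem_QPos hα
  obtain ⟨d, rfl⟩ := S.exists_of_mem_QPos hβ
  rw [← Finset.sum_add_distrib] at h
  simp only [← add_smul] at h
  have hz := Fintype.linearIndependent_iff.1 S.linearIndependent_root _ h
  refine Finset.sum_eq_zero fun i _ => ?_
  have : c i + d i = 0 := by exact_mod_cast hz i
  have : c i = 0 := by omega
  simp [this]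

/-- The subspace spanned by the root vectors for the nonzero elements of `Q⁺`. -/
def positivePart : Submodule ℂ L :=
  ⨆ α ∈ {α : Module.Dual ℂ S.T | α ∈ S.QPos ∧ α ≠ 0}, S.rootSpace α

/-- Pointedness of `Q⁺` keeps the sum of two nonzero weights nonzero, so the right-hand side is a
subalgebra. -/
lemma nPos_le_positivePart : S.nPos ≤ S.positivePart := by
  refine lieSpan_le ?_ ?_
  · rintro _ ⟨i, rfl⟩
    exact Submodule.mem_iSup_of_mem _ (Submodule.mem_iSup_of_mem
      ⟨S.root_mem_QPos i, S.linearIndependent_root.ne_zero i⟩ (S.X_mem_rootSpace i))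
  · intro x hx y hy
    rw [positivePart, iSup_subtype'] at hx hy
    induction hx using Submodule.iSup_induction' with
    | zero => simp
    | add x x' _ _ h1 h2 => rw [map_add, LinearMap.add_apply]; exact add_mem h1 h2
    | mem α x hx =>
      induction hy using Submodule.iSup_induction' with
      | zero => simp
      | add x x' _ _ h1 h2 => rw [map_add]; exact add_mem h1 h2
      | mem β y hy =>
        exact Submodule.mem_iSup_of_mem (α.1 + β.1) (Submodule.mem_iSup_of_mem
          ⟨add_mem α.2.1 β.2.1, fun h => α.2.2 (S.eq_zero_of_add_eq_zero α.2.1 β.2.1 h)⟩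
          (br_rootSpace hx hy))

lemma iteratedBracket_Y {y : L} (hy : IteratedBracket S.Y y) :
    ∃ α, -α ∈ S.QPos ∧ y ∈ S.rootSpace α := by
  induction hy with
  | of i => exact ⟨_, by simpa using S.root_mem_QPos i, S.Y_mem_rootSpace i⟩
  | br i _ ih =>
    obtain ⟨α, hα, hy⟩ := ih
    refine ⟨_, ?_, br_rootSpace (S.Y_mem_rootSpace i) hy⟩
    rw [neg_add, neg_neg]
    exact add_mem (S.root_mem_QPos i) hα

lemma iteratedBracket_X {x : L} (hx : IteratedBracket S.X x) :
    ∃ α, x ∈ S.rootSpace α ⊓ S.nPos := by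
  induction hx with
  | of i => exact ⟨_, S.X_mem_rootSpace i, subset_lieSpan _ ⟨i, rfl⟩⟩
  | br i _ ih =>
    obtain ⟨α, hx⟩ := ih
    exact ⟨_, br_rootSpace (S.X_mem_rootSpace i) hx.1,
      br_mem_lieSpan (subset_lieSpan _ ⟨i, rfl⟩) hx.2⟩

/-- A root vector lies in `n⁺`, unless its weight is in `-Q⁺`. -/
lemma rootSpace_le_nPos {α : Module.Dual ℂ S.T} (hα : -α ∉ S.QPos) : S.rootSpace α ≤ S.nPos := by
  classical
  -- Each root space is cut down to `n⁺` exactly where the claim is to be proved. The triangular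
  -- decomposition shows that the smaller spaces still span `L`, and independence of the root spaces
  -- then forces equality.
  let q : Module.Dual ℂ S.T → Submodule ℂ L := fun α =>
    if -α ∈ S.QPos then S.rootSpace α else S.rootSpace α ⊓ S.nPos
  have hle : ∀ α, S.rootSpace α ⊓ S.nPos ≤ q α := by
    intro α
    by_cases h : -α ∈ S.QPos <;> simp [q, h]
  have hneg : ∀ α, -α ∈ S.QPos → S.rootSpace α ≤ q α := fun α h => by simp [q, h]
  have hq : ⨆ α, q α = ⊤ := by
    rw [eq_top_iff, ← S.iteratedSpan_sup_eq_top]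
    refine sup_le (sup_le (Submodule.span_le.2 ?_) ?_) (Submodule.span_le.2 ?_)
    · intro y hy
      obtain ⟨α, hα, hy⟩ := S.iteratedBracket_Y hy
      exact Submodule.mem_iSup_of_mem α (hneg α hα hy)
    · intro x hx
      exact Submodule.mem_iSup_of_mem 0
        (hneg 0 (by simp) (S.mem_h_iff_mem_rootSpace_zero.1 hx))
    · intro x hx
      obtain ⟨α, hx⟩ := S.iteratedBracket_X hx
      exact Submodule.mem_iSup_of_mem α (hle α hx)
  have h := S.iSupIndep_rootSpace.eq_of_le_of_iSup_eq_top (q := q) (fun α => by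
    by_cases h : -α ∈ S.QPos <;> simp [q, h]) hq α
  rw [← h]
  simp [q, hα]

end SimpleSystem

end Triangular

/-! ### Straightening in the enveloping algebra. -/

section Straightening

variable {L : Type*} [AddCommGroup L] [Module ℂ L] [LieSuperalgebra L]
  {A : Type*} [CommRing A] [Algebra ℂ A]

lemma ι_mul_ι_of_mem_parity {i j : ZMod 2} {x y : L} (hx : x ∈ parity (L := L) i)
    (hy : y ∈ parity (L := L) j) (a b : A) :
    Env.ι (x ⊗ₜ[ℂ] a) * Env.ι (y ⊗ₜ[ℂ] b) =
      Env.ι (br x y ⊗ₜ[ℂ] (a * b)) +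
        koszul i j • (Env.ι (y ⊗ₜ[ℂ] b) * Env.ι (x ⊗ₜ[ℂ] a)) := by
  have h := Env.ι_br (L := L ⊗[ℂ] A) (i := i) (j := j)
    (Submodule.subset_span ⟨x, hx, a, rfl⟩) (Submodule.subset_span ⟨y, hy, b, rfl⟩)
  rw [sub_eq_iff_eq_add] at h
  rw [h]
  congr 2

namespace SimpleSystem

variable (S : SimpleSystem L)

/-- The torus is even, so the eigenvector equation splits into its even and odd parts. This reduces
supercommutation of root vectors to homogeneous ones. -/
lemma exists_parity_decomposition_rootSpace {α : Module.Dual ℂ S.T} {x : L}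
    (hx : x ∈ S.rootSpace α) :
    ∃ y ∈ parity (L := L) 0, ∃ z ∈ parity (L := L) 1, x = y + z ∧
      y ∈ S.rootSpace α ∧ z ∈ S.rootSpace α := by
  obtain ⟨y, hy, z, hz, rfl⟩ := exists_parity_decomposition x
  have key : y ∈ S.rootSpace α := by
    intro t
    have h := hx t
    rw [map_add, smul_add, ← sub_eq_zero, add_sub_add_comm] at h
    have h0 := sub_mem (S.T_even _ t.2 0 y hy) (Submodule.smul_mem _ (α t) hy)
    have h1 := sub_mem (S.T_even _ t.2 1 z hz) (Submodule.smul_mem _ (α t) hz)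
    rw [← sub_eq_zero]
    refine Submodule.disjoint_def.1 (isCompl_parity (L := L)).disjoint _ h0 ?_
    rw [eq_neg_of_add_eq_zero_left h]
    exact neg_mem h1
  refine ⟨y, hy, z, hz, rfl, key, ?_⟩
  simpa using sub_mem hx key

variable (A) in
/-- The span of the products of at most `k` root vectors of total weight `μ` such that the weights
of all factors are in `-Q⁺`. -/
def nonposComponent (k : ℕ) (μ : Module.Dual ℂ S.T) : Submodule ℂ (Env (L ⊗[ℂ] A)) :=
  Submodule.span ℂ {u | ∃ l : List (Module.Dual ℂ S.T × L × A), l.length ≤ k ∧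
    (∀ q ∈ l, q.2.1 ∈ S.rootSpace q.1 ∧ -q.1 ∈ S.QPos) ∧ (l.map fun q => q.1).sum = μ ∧
    u = (l.map fun q => Env.ι (q.2.1 ⊗ₜ[ℂ] q.2.2)).prod}

lemma nonposComponent_mono {k k' : ℕ} (h : k ≤ k') (μ : Module.Dual ℂ S.T) :
    S.nonposComponent A k μ ≤ S.nonposComponent A k' μ := by
  refine Submodule.span_mono ?_
  rintro u ⟨l, hl, h'⟩
  exact ⟨l, hl.trans h, h'⟩

/-- A sum of weights in `-Q⁺` stays in `-Q⁺`, so no product of the required kind has weight `μ`. -/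
lemma nonposComponent_eq_bot (k : ℕ) {μ : Module.Dual ℂ S.T} (hμ : -μ ∉ S.QPos) :
    S.nonposComponent A k μ = ⊥ := by
  rw [nonposComponent, Submodule.span_eq_bot]
  rintro u ⟨l, -, hl, rfl, -⟩
  refine absurd ?_ hμ
  clear hμ
  induction l with
  | nil => simp
  | cons q l ih =>
    rw [List.map_cons, List.sum_cons, neg_add]
    exact add_mem (hl q (by simp)).2 (ih fun q hq => hl q (by simp [hq]))

variable (J : Ideal (Env (L ⊗[ℂ] A)))

/-- Modulo a left ideal which contains `n⁺ ⊗ A`, the components of the enveloping algebra are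
spanned by products of root vectors with weights in `-Q⁺`. -/
lemma prod_mem_sup_nonposComponent
    (hJ : ∀ x ∈ S.nPos, ∀ a : A, Env.ι (x ⊗ₜ[ℂ] a) ∈ J) (k : ℕ) :
    ∀ l : List (Module.Dual ℂ S.T × L × A), l.length ≤ k → (∀ q ∈ l, q.2.1 ∈ S.rootSpace q.1) →
      (l.map fun q => Env.ι (q.2.1 ⊗ₜ[ℂ] q.2.2)).prod ∈
        J.restrictScalars ℂ ⊔ S.nonposComponent A k (l.map fun q => q.1).sum := by
  -- A factor with weight in `-Q⁺` may be put in front at the cost of one more factor; `J` absorbs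
  -- it, being a left ideal.
  have hmul : ∀ (k : ℕ) (α μ : Module.Dual ℂ S.T) (x : L) (a : A) (u : Env (L ⊗[ℂ] A)),
      x ∈ S.rootSpace α → -α ∈ S.QPos → u ∈ J.restrictScalars ℂ ⊔ S.nonposComponent A k μ →
      Env.ι (x ⊗ₜ[ℂ] a) * u ∈ J.restrictScalars ℂ ⊔ S.nonposComponent A (k + 1) (α + μ) := by
    intro k α μ x a u hx hα hu
    obtain ⟨j, hj, c, hc, rfl⟩ := Submodule.mem_sup.1 hu
    rw [mul_add]
    refine add_mem (Submodule.mem_sup_left (J.mul_mem_left _ hj)) (Submodule.mem_sup_right ?_)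
    induction hc using Submodule.span_induction with
    | zero => simp
    | add y z hy hz h1 h2 =>
      rw [mul_add]
      exact add_mem (h1 (Submodule.mem_sup.2 ⟨j, hj, y, hy, rfl⟩))
        (h2 (Submodule.mem_sup.2 ⟨j, hj, z, hz, rfl⟩))
    | smul c y hy h =>
      rw [mul_smul_comm]
      exact Submodule.smul_mem _ _ (h (Submodule.mem_sup.2 ⟨j, hj, y, hy, rfl⟩))
    | mem y hy =>
      obtain ⟨l, hk, hl, rfl, rfl⟩ := hy
      refine Submodule.subset_span ⟨(α, x, a) :: l, by simpa using hk, ?_, by simp, by simp⟩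
      intro q hq
      rcases List.mem_cons.1 hq with rfl | hq
      exacts [⟨hx, hα⟩, hl q hq]
  induction k with
  | zero =>
    intro l hl _
    obtain rfl : l = [] := List.length_eq_zero_iff.1 (Nat.le_zero.1 hl)
    exact Submodule.mem_sup_right (Submodule.subset_span ⟨[], by simp, by simp, rfl, rfl⟩)
  | succ k ih =>
    rintro (_ | ⟨⟨α, x, a⟩, l⟩) hlen hl
    · exact Submodule.mem_sup_right (Submodule.subset_span ⟨[], by simp, by simp, rfl, rfl⟩)
    have hx : x ∈ S.rootSpace α := hl (α, x, a) (by simp)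
    have ihl := ih l (by simpa using hlen) fun q hq => hl q (by simp [hq])
    simp only [List.map_cons, List.prod_cons, List.sum_cons]
    by_cases hα : -α ∈ S.QPos
    · exact hmul k α _ x a _ hx hα ihl
    -- The leading factor `x` now lies in `n⁺`. By induction the tail may be replaced by products of
    -- at most `k` factors with weights in `-Q⁺`, through which `x` is moved to the right.
    obtain ⟨j, hj, c, hc, e⟩ := Submodule.mem_sup.1 ihl
    rw [← e, mul_add]
    refine add_mem (Submodule.mem_sup_left (J.mul_mem_left _ hj)) ?_
    clear e ihl hlen hl
    generalize (l.map fun q => q.1).sum = μ at *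
    clear l
    induction hc using Submodule.span_induction with
    | zero => simp
    | add y z _ _ h1 h2 => rw [mul_add]; exact add_mem h1 h2
    | smul c y _ h => rw [mul_smul_comm]; exact Submodule.smul_mem _ _ h
    | mem u hu =>
      obtain ⟨l, hk, hl, rfl, rfl⟩ := hu
      -- With no factor left to pass, `x ⊗ a` itself is in `J`.
      rcases l with _ | ⟨⟨β, y, b⟩, l⟩
      · refine Submodule.mem_sup_left ?_
        simpa using hJ x (S.rootSpace_le_nPos hα hx) a
      obtain ⟨hy, hβ⟩ : y ∈ S.rootSpace β ∧ -β ∈ S.QPos := hl (β, y, b) (by simp)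
      have hl' : ∀ q ∈ l, q.2.1 ∈ S.rootSpace q.1 := fun q hq => (hl q (by simp [hq])).1
      simp only [List.length_cons] at hk
      simp only [List.map_cons, List.prod_cons, List.sum_cons]
      -- Supercommuting `x` past `y` gives two terms. The one with `[x, y]` has at most `k` factors.
      -- In the other, `x` times the remaining factors again has length at most `k`, and `y`, with
      -- weight in `-Q⁺`, is put back by `hmul`. The length bound in `nonposComponent` is what makes
      -- this induction close.
      have key : ∀ (i j : ZMod 2) (x y : L), x ∈ S.rootSpace α → y ∈ S.rootSpace β →
          x ∈ parity (L := L) i → y ∈ parity (L := L) j →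
          Env.ι (x ⊗ₜ[ℂ] a) * (Env.ι (y ⊗ₜ[ℂ] b) *
              (l.map fun q => Env.ι (q.2.1 ⊗ₜ[ℂ] q.2.2)).prod) ∈ J.restrictScalars ℂ ⊔
            S.nonposComponent A (k + 1) (α + (β + (l.map fun q => q.1).sum)) := by
        intro i j x y hx hy hi hj
        rw [← mul_assoc, ι_mul_ι_of_mem_parity hi hj, add_mul, smul_mul_assoc, mul_assoc]
        refine add_mem ?_ (Submodule.smul_mem _ _ ?_)
        · have h := ih ((α + β, br x y, a * b) :: l) (by simpa using hk) (by
            intro q hq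
            rcases List.mem_cons.1 hq with rfl | hq
            exacts [br_rootSpace hx hy, hl' q hq])
          simp only [List.map_cons, List.prod_cons, List.sum_cons, add_assoc] at h
          exact sup_le_sup le_rfl (S.nonposComponent_mono (Nat.le_succ k) _) h
        · have h := ih ((α, x, a) :: l) (by simpa using hk) (by
            intro q hq
            rcases List.mem_cons.1 hq with rfl | hq
            exacts [hx, hl' q hq])
          simp only [List.map_cons, List.prod_cons, List.sum_cons] at h
          rw [add_left_comm]
          exact hmul k β _ y b _ hy hβ h
      obtain ⟨x₀, hx₀, x₁, hx₁, rfl, hx₀', hx₁'⟩ := S.exists_parity_decomposition_rootSpace hx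
      obtain ⟨y₀, hy₀, y₁, hy₁, rfl, hy₀', hy₁'⟩ := S.exists_parity_decomposition_rootSpace hy
      simp only [TensorProduct.add_tmul, map_add, add_mul, mul_add]
      exact add_mem
        (add_mem (key _ _ _ _ hx₀' hy₀' hx₀ hy₀) (key _ _ _ _ hx₁' hy₀' hx₁ hy₀))
        (add_mem (key _ _ _ _ hx₀' hy₁' hx₀ hy₁) (key _ _ _ _ hx₁' hy₁' hx₁ hy₁))

lemma envComponent_le_of_nPos_mem (hJ : ∀ x ∈ S.nPos, ∀ a : A, Env.ι (x ⊗ₜ[ℂ] a) ∈ J)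
    {μ : Module.Dual ℂ S.T} (hμ : -μ ∉ S.QPos) : S.envComponent A μ ≤ J.restrictScalars ℂ := by
  refine Submodule.span_le.2 ?_
  rintro _ ⟨l, hl, rfl, rfl⟩
  have h := S.prod_mem_sup_nonposComponent J hJ l.length l le_rfl hl
  rwa [S.nonposComponent_eq_bot _ hμ, sup_bot_eq] at h

/-- A nonzero weight in `Q⁺` is never in `-Q⁺`, so `n⁺ ⊗ A` lies in the components that the
truncation kills. -/
lemma ι_mem_iSup_envComponent {x : L} (hx : x ∈ S.nPos) (a : A) :
    Env.ι (x ⊗ₜ[ℂ] a) ∈ ⨆ μ ∈ {μ : Module.Dual ℂ S.T | -μ ∉ S.QPos}, S.envComponent A μ := by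
  replace hx := S.nPos_le_positivePart hx
  rw [positivePart, iSup_subtype'] at hx
  induction hx using Submodule.iSup_induction' with
  | zero => simp
  | add x y _ _ h1 h2 => rw [TensorProduct.add_tmul, map_add]; exact add_mem h1 h2
  | mem α x hx =>
    refine Submodule.mem_iSup_of_mem α.1 (Submodule.mem_iSup_of_mem ?_
      (Submodule.subset_span ⟨[(α.1, x, a)], by simpa using hx, by simp, by simp⟩))
    exact fun h => α.2.2 (S.eq_zero_of_add_eq_zero α.2.1 h (add_neg_cancel _))

end SimpleSystem

end Straightening

/-! ### Comparison of the global Weyl module with its presentation. -/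

section Presentation

variable {L : Type*} [AddCommGroup L] [Module ℂ L] [LieSuperalgebra L]
  {S : SimpleSystem L} (E : S.EvenTriples) (lam : Module.Dual ℂ S.h)
  (A : Type*) [CommRing A] [Algebra ℂ A]

lemma envMap_ι (x : L) : envMap L A (Env.ι x) = Env.ι (x ⊗ₜ[ℂ] (1 : A)) :=
  Env.lift_ι _ _ x

namespace SimpleSystem

lemma span_inducedGen :
    Submodule.span (Env (L ⊗[ℂ] A)) {inducedGen E lam A} = ⊤ := by
  rw [eq_top_iff]
  rintro z -
  obtain ⟨z, rfl⟩ := Submodule.Quotient.mk_surjective _ z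
  induction z with
  | zero => exact zero_mem _
  | add x y hx hy => exact add_mem hx hy
  | tmul s v =>
    obtain ⟨r, rfl⟩ := Submodule.Quotient.mk_surjective _ v
    -- Balancing moves `r` across the tensor sign: `s ⊗ r v_λ = s φ(r) ⊗ v_λ`, where `φ = envMap L
    -- A`.
    refine Submodule.mem_span_singleton.2 ⟨s * envMap L A r, ?_⟩
    rw [inducedGen, ← Submodule.Quotient.mk_smul, Submodule.Quotient.eq]
    refine Submodule.subset_span ⟨s, r, kacGen E lam, ?_⟩
    rw [TensorProduct.smul_tmul', smul_eq_mul, mul_one, kacGen, ← Submodule.Quotient.mk_smul,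
      smul_eq_mul, mul_one]

lemma span_weylGen : Submodule.span (Env (L ⊗[ℂ] A)) {weylGen E lam A} = ⊤ := by
  have h := congrArg (Submodule.map (Submodule.mkQ (S.truncationKernel A (inducedGen E lam A))))
    (span_inducedGen E lam A)
  rw [Submodule.map_span, Set.image_singleton, Submodule.map_top, Submodule.range_mkQ] at h
  exact h

lemma envMap_smul_inducedGen (r : Env L) :
    envMap L A r • inducedGen E lam A =
      Submodule.Quotient.mk (1 ⊗ₜ[ℂ] (Submodule.Quotient.mk r : KacModule E lam)) := by
  rw [inducedGen, ← Submodule.Quotient.mk_smul, Submodule.Quotient.eq]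
  refine Submodule.subset_span ⟨1, r, kacGen E lam, ?_⟩
  rw [TensorProduct.smul_tmul', smul_eq_mul, mul_one, one_mul, kacGen,
    ← Submodule.Quotient.mk_smul, smul_eq_mul, mul_one]

lemma envMap_smul_inducedGen_eq_zero {r : Env L} (hr : r ∈ kacIdeal E lam) :
    envMap L A r • inducedGen E lam A = 0 := by
  rw [envMap_smul_inducedGen, (Submodule.Quotient.mk_eq_zero _).2 hr, TensorProduct.tmul_zero,
    Submodule.Quotient.mk_zero]

lemma smul_weylGen_eq_zero {u : Env (L ⊗[ℂ] A)} (hu : u • inducedGen E lam A = 0) :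
    u • weylGen E lam A = 0 := by
  rw [weylGen, ← Submodule.Quotient.mk_smul, hu, Submodule.Quotient.mk_zero]

lemma smul_weylGen_of_mem_envComponent {μ : Module.Dual ℂ S.T} (hμ : -μ ∉ S.QPos)
    {u : Env (L ⊗[ℂ] A)} (hu : u ∈ S.envComponent A μ) : u • weylGen E lam A = 0 := by
  rw [weylGen, ← Submodule.Quotient.mk_smul, Submodule.Quotient.mk_eq_zero]
  exact Submodule.subset_span (Set.mem_biUnion (x := μ) hμ ⟨u, hu, rfl⟩)

/-- The defining relations of the global Weyl module hold for its generator. -/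
lemma weylIdeal_le_ker :
    weylIdeal E lam A ≤ LinearMap.ker (LinearMap.toSpanSingleton (Env (L ⊗[ℂ] A)) _
      (weylGen E lam A)) := by
  refine Submodule.span_le.2 ?_
  rintro u ((⟨x, hx, a, rfl⟩ | ⟨x, rfl⟩) | ⟨α, m, hm, rfl⟩)
  -- Only this family of relations uses the truncation; the other two already hold in the induced
  -- module.
  · have hle : ⨆ μ ∈ {μ : Module.Dual ℂ S.T | -μ ∉ S.QPos}, S.envComponent A μ ≤
        (LinearMap.ker (LinearMap.toSpanSingleton (Env (L ⊗[ℂ] A)) _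
          (weylGen E lam A))).restrictScalars ℂ :=
      iSup₂_le fun μ hμ u hu => smul_weylGen_of_mem_envComponent E lam A hμ hu
    exact hle (S.ι_mem_iSup_envComponent hx a)
  · refine smul_weylGen_eq_zero E lam A ?_
    rw [← envMap_ι, ← (envMap L A).commutes, ← map_sub]
    exact envMap_smul_inducedGen_eq_zero E lam A
      (Ideal.subset_span (Or.inl (Or.inr ⟨x, rfl⟩)))
  · refine smul_weylGen_eq_zero E lam A ?_
    rw [← envMap_ι, ← map_pow]
    exact envMap_smul_inducedGen_eq_zero E lam A
      (Ideal.subset_span (Or.inr ⟨α, m, hm, rfl⟩))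

lemma nPos_mem_weylIdeal {x : L} (hx : x ∈ S.nPos) (a : A) :
    Env.ι (x ⊗ₜ[ℂ] a) ∈ weylIdeal E lam A :=
  Ideal.subset_span (Or.inl (Or.inl ⟨x, hx, a, rfl⟩))

/-- Each Kac relation becomes a Weyl relation, with `a = 1` for `n⁺`. This makes the map out of the
Kac module well defined. -/
lemma envMap_mem_weylIdeal {r : Env L} (hr : r ∈ kacIdeal E lam) :
    envMap L A r ∈ weylIdeal E lam A := by
  induction hr using Submodule.span_induction with
  | zero => simp
  | add x y _ _ h1 h2 => rw [map_add]; exact add_mem h1 h2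
  | smul c x _ h => rw [smul_eq_mul, map_mul]; exact Ideal.mul_mem_left _ _ h
  | mem u h =>
    rcases h with (⟨x, hx, rfl⟩ | ⟨x, rfl⟩) | ⟨α, m, hm, rfl⟩
    · rw [envMap_ι]
      exact nPos_mem_weylIdeal E lam A hx 1
    · rw [map_sub, envMap_ι, AlgHom.commutes]
      exact Ideal.subset_span (Or.inl (Or.inr ⟨x, rfl⟩))
    · rw [map_pow, envMap_ι]
      exact Ideal.subset_span (Or.inr ⟨α, m, hm, rfl⟩)

/-- The map from the generalized Kac module to the module given by the defining relations of the
global Weyl module. -/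
def kacToPresented : KacModule E lam →ₗ[ℂ] Env (L ⊗[ℂ] A) ⧸ weylIdeal E lam A :=
  Submodule.liftQ ((kacIdeal E lam).restrictScalars ℂ)
      (((weylIdeal E lam A).mkQ.restrictScalars ℂ) ∘ₗ (envMap L A).toLinearMap) (fun r hr => by
    simpa using envMap_mem_weylIdeal E lam A hr)

lemma kacToPresented_mk (r : Env L) :
    kacToPresented E lam A (Submodule.Quotient.mk r) = Submodule.Quotient.mk (envMap L A r) :=
  rfl

/-- The map from the induced module to the module given by the defining relations of the global
Weyl module. -/
def inducedToPresented :
    Induced L A (KacModule E lam) →ₗ[Env (L ⊗[ℂ] A)] Env (L ⊗[ℂ] A) ⧸ weylIdeal E lam A :=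
  Submodule.liftQ _ (TensorProduct.AlgebraTensorModule.lift
    ((LinearMap.toSpanSingleton (Env (L ⊗[ℂ] A)) _ (kacToPresented E lam A)))) (by
    refine Submodule.span_le.2 ?_
    -- The Kac map is only recorded as `ℂ`-linear; its compatibility with `U(L)` is what the
    -- balancing relations require, and it reduces to multiplicativity of `envMap`.
    rintro _ ⟨s, r, v, rfl⟩
    obtain ⟨v, rfl⟩ := Submodule.Quotient.mk_surjective _ v
    rw [SetLike.mem_coe, LinearMap.mem_ker, map_sub, ← Submodule.Quotient.mk_smul]
    simp only [TensorProduct.AlgebraTensorModule.lift_apply, TensorProduct.lift.tmul,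
      LinearMap.restrictScalars_apply, LinearMap.toSpanSingleton_apply, LinearMap.smul_apply,
      kacToPresented_mk, smul_eq_mul, map_mul]
    rw [← Submodule.Quotient.mk_smul, ← Submodule.Quotient.mk_smul, smul_eq_mul, smul_eq_mul,
      mul_assoc, sub_self])

lemma inducedToPresented_inducedGen :
    inducedToPresented E lam A (inducedGen E lam A) = Submodule.Quotient.mk 1 := by
  change (1 : Env (L ⊗[ℂ] A)) • kacToPresented E lam A (Submodule.Quotient.mk 1) = _
  rw [one_smul, kacToPresented_mk, map_one]

/-- The map from the global Weyl module to the module given by its defining relations. -/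
def weylToPresented :
    GlobalWeyl E lam A →ₗ[Env (L ⊗[ℂ] A)] Env (L ⊗[ℂ] A) ⧸ weylIdeal E lam A :=
  Submodule.liftQ _ (inducedToPresented E lam A) (by
    refine Submodule.span_le.2 (Set.iUnion₂_subset fun μ hμ => ?_)
    rintro _ ⟨u, hu, rfl⟩
    rw [SetLike.mem_coe, LinearMap.mem_ker, map_smul, inducedToPresented_inducedGen,
      ← Submodule.Quotient.mk_smul, smul_eq_mul, mul_one, Submodule.Quotient.mk_eq_zero]
    exact S.envComponent_le_of_nPos_mem _ (fun x hx a => nPos_mem_weylIdeal E lam A hx a) hμ hu)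

lemma weylToPresented_smul_weylGen (u : Env (L ⊗[ℂ] A)) :
    weylToPresented E lam A (u • weylGen E lam A) = Submodule.Quotient.mk u := by
  have h : weylToPresented E lam A (weylGen E lam A) = Submodule.Quotient.mk 1 :=
    inducedToPresented_inducedGen E lam A
  rw [map_smul, h, ← Submodule.Quotient.mk_smul, smul_eq_mul, mul_one]

/-- If `u` kills `w_λ`, applying `weylToPresented` to `u w_λ = 0` shows that the class of `u` modulo
the ideal vanishes. -/
lemma ker_toSpanSingleton_weylGen :
    LinearMap.ker (LinearMap.toSpanSingleton (Env (L ⊗[ℂ] A)) _ (weylGen E lam A)) =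
      weylIdeal E lam A := by
  refine le_antisymm (fun u hu => ?_) (weylIdeal_le_ker E lam A)
  rw [LinearMap.mem_ker, LinearMap.toSpanSingleton_apply] at hu
  rw [← Submodule.Quotient.mk_eq_zero, ← weylToPresented_smul_weylGen, hu, map_zero]

/-- The isomorphism of the module given by the defining relations with the global Weyl module. -/
def presentedEquivWeyl :
    (Env (L ⊗[ℂ] A) ⧸ weylIdeal E lam A) ≃ₗ[Env (L ⊗[ℂ] A)] GlobalWeyl E lam A :=
  (Submodule.quotEquivOfEq _ _ (ker_toSpanSingleton_weylGen E lam A).symm).trans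
    (LinearMap.quotKerEquivOfSurjective _ (by
      rw [← LinearMap.range_eq_top, LinearMap.range_toSpanSingleton, span_weylGen]))

lemma presentedEquivWeyl_one :
    presentedEquivWeyl E lam A (Submodule.Quotient.mk 1) = weylGen E lam A := by
  rw [presentedEquivWeyl, LinearEquiv.trans_apply, Submodule.quotEquivOfEq_mk,
    LinearMap.quotKerEquivOfSurjective_apply_mk, LinearMap.toSpanSingleton_apply, one_smul]

end SimpleSystem

end Presentation

end SuperWeyl

end

theorem proposition3p4 {L : Type*} [AddCommGroup L] [Module ℂ L] [SuperWeyl.LieSuperalgebra L]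
    (hL : SuperWeyl.IsBasic L ∨ ∃ n : ℕ, 2 ≤ n ∧ SuperWeyl.IsSpecialLinear L n)
    {A : Type*} [CommRing A] [Algebra ℂ A]
    (S : SuperWeyl.SimpleSystem L) (E : S.EvenTriples)
    (lam : Module.Dual ℂ S.h) (hlam : lam ∈ S.dominant) :
    Submodule.span (SuperWeyl.Env (TensorProduct ℂ L A))
        {SuperWeyl.SimpleSystem.weylGen E lam A} = ⊤ ∧
      ∃ e : (SuperWeyl.Env (TensorProduct ℂ L A) ⧸ SuperWeyl.SimpleSystem.weylIdeal E lam A)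
          ≃ₗ[SuperWeyl.Env (TensorProduct ℂ L A)] SuperWeyl.SimpleSystem.GlobalWeyl E lam A,
        e (Submodule.Quotient.mk 1) = SuperWeyl.SimpleSystem.weylGen E lam A := by
  exact ⟨SuperWeyl.SimpleSystem.span_weylGen E lam A,
    SuperWeyl.SimpleSystem.presentedEquivWeyl E lam A,
    SuperWeyl.SimpleSystem.presentedEquivWeyl_one E lam A⟩
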